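/- Fix an infinite set $\Delta$ of constants and a finite binary relational signature $\Sigma$, that is, a finite set of relation symbols each of which is unary or binary. A fact is an atom over $\Sigma$ with arguments in $\Delta$; a database instance is a set of facts, distinct constants denoting distinct elements. A (Boolean) conjunctive query is a finite conjunction of atoms over $\Sigma$ whose arguments are variables or constants, all variables being existentially quantified. A theory $\mathcal T$ is a finite set of rules, each of which is either a plain datalog rule $\forall\bar x\,(\Phi(\bar x)\Rightarrow Q(\bar y))$ or a single-head existential TGD $\forall\bar x\,(\Phi(\bar x)\Rightarrow\exists z\,Q(z,\bar y))$, where $\Phi$ is a conjunction of atoms, $Q$ is a relation symbol, $\bar x$ is the tuple of variables of $\Phi$, $z$ is a variable not in $\bar x$ that occurs in the head exactly once (at any position), and each entry of $\bar y$ is a variable from $\bar x$ or a constant. For a finite database instance $D$ and a conjunctive query $\Phi$ write $\mathcal T,D\models\Phi$ if $\Phi$ is true in every (finite or infinite) database instance $M\supseteq D$ that satisfies all the rules of $\mathcal T$. Theorem. Suppose that $\mathcal T$ has the Bounded Derivation Depth property (UCQ-rewritability): for each conjunctive query $\Phi$ there is a finite union $\Phi'$ of conjunctive queries such that for every finite database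 instance $D$, $\mathcal T,D\models\Phi$ if and only if $D\models\Phi'$. Then $\mathcal T$ is finitely controllable: for every finite database instance $D$ and every conjunctive query $\Phi$, if $\mathcal T,D\not\models\Phi$, then there is a finite database instance $M\supseteq D$ that satisfies all the rules of $\mathcal T$ and in which $\Phi$ is false. -/

import Mathlib

universe u v

namespace DatalogEx

/-- A relational signature. Constants are not listed here: the constants that may be used in
facts, queries and rules are the elements of a fixed infinite set `Δ`. -/
structure Signature where
  /-- the relation symbols -/
  Pred : Type u
  /-- the arity of a relation symbol -/
  arity : Pred → ℕ

/-- A binary signature: every relation symbol is unary or binary. -/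
def Signature.IsBinary (S : Signature.{u}) : Prop :=
  ∀ p : S.Pred, S.arity p = 1 ∨ S.arity p = 2

/-- Atoms over `S` whose arguments are taken from `A`. -/
structure Atom (S : Signature.{u}) (A : Type v) where
  /-- the relation symbol -/
  pred : S.Pred
  /-- the arguments -/
  args : Fin (S.arity pred) → A

/-- Terms: constants (elements of `Δ`) and variables. -/
inductive Term (Δ : Type v) where
  | const (c : Δ) : Term Δ
  | var (x : ℕ) : Term Δ

/-- The value of a term under a valuation of the variables. -/
def Term.eval {Δ : Type v} (ν : ℕ → Δ) : Term Δ → Δ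
  | .const c => c
  | .var x => ν x

/-- The fact obtained from an atom by a valuation of its variables. -/
def Atom.ground {S : Signature.{u}} {Δ : Type v} (α : Atom S (Term Δ)) (ν : ℕ → Δ) : Atom S Δ :=
  ⟨α.pred, fun i => (α.args i).eval ν⟩

/-- The variable `x` occurs in the atom `α`. -/
def Atom.HasVar {S : Signature.{u}} {Δ : Type v} (α : Atom S (Term Δ)) (x : ℕ) : Prop :=
  ∃ i, α.args i = .var x

/-- A database instance: a (possibly infinite) set of facts. -/
abbrev DBInstance (S : Signature.{u}) (Δ : Type v) := Set (Atom S Δ)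

/-- A conjunction of atoms. As a query it is Boolean: all its variables are existentially
quantified. -/
abbrev ConjQuery (S : Signature.{u}) (Δ : Type v) := List (Atom S (Term Δ))

/-- The variable `x` occurs in the query `Φ`. -/
def ConjQuery.HasVar {S : Signature.{u}} {Δ : Type v} (Φ : ConjQuery S Δ) (x : ℕ) : Prop :=
  ∃ α ∈ Φ, α.HasVar x

/-- All atoms of `Φ` are true in `D` under the valuation `ν`. -/
def ConjQuery.HoldsAt {S : Signature.{u}} {Δ : Type v} (Φ : ConjQuery S Δ) (D : DBInstance S Δ)
    (ν : ℕ → Δ) : Prop :=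
  ∀ α ∈ Φ, α.ground ν ∈ D

/-- `D ⊨ Φ` for a Boolean conjunctive query `Φ`. -/
def ConjQuery.Holds {S : Signature.{u}} {Δ : Type v} (Φ : ConjQuery S Δ) (D : DBInstance S Δ) :
    Prop :=
  ∃ ν : ℕ → Δ, Φ.HoldsAt D ν

/-- A (finite) union of conjunctive queries. -/
abbrev UnionQuery (S : Signature.{u}) (Δ : Type v) := List (ConjQuery S Δ)

/-- `D ⊨ U` for a union of conjunctive queries `U`. -/
def UnionQuery.Holds {S : Signature.{u}} {Δ : Type v} (U : UnionQuery S Δ) (D : DBInstance S Δ) :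
    Prop :=
  ∃ Ψ ∈ U, ConjQuery.Holds Ψ D

/-- Rules with a single atom in the head. -/
inductive Rule (S : Signature.{u}) (Δ : Type v) where
  /-- A plain datalog rule: every variable of the head occurs in the body. -/
  | datalog (body : ConjQuery S Δ) (head : Atom S (Term Δ))
      (safe : ∀ x, head.HasVar x → body.HasVar x) : Rule S Δ
  /-- An existential TGD `body ⇒ ∃ z, head`: the variable `z` does not occur in the body, it is the
  argument of the head at the position `pos`, and every variable at another position of the head
  occurs in the body (so that `z` occurs in the head exactly once). -/
  | tgd (body : ConjQuery S Δ) (z : ℕ) (head : Atom S (Term Δ)) (pos : Fin (S.arity head.pred))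
      (fresh : ¬ body.HasVar z) (witness : head.args pos = .var z)
      (safe : ∀ i, i ≠ pos → ∀ x, head.args i = .var x → body.HasVar x) : Rule S Δ

/-- The rule is true in `D`. -/
def Rule.Holds {S : Signature.{u}} {Δ : Type v} (D : DBInstance S Δ) : Rule S Δ → Prop
  | .datalog body head _ => ∀ ν : ℕ → Δ, body.HoldsAt D ν → head.ground ν ∈ D
  | .tgd body z head _ _ _ _ =>
      ∀ ν : ℕ → Δ, body.HoldsAt D ν → ∃ c : Δ, head.ground (Function.update ν z c) ∈ D

/-- A set of rules; finiteness is a separate hypothesis. -/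
abbrev RuleSet (S : Signature.{u}) (Δ : Type v) := Set (Rule S Δ)

/-- `M` is a model of the database instance `D` and of the rules `T`. -/
def IsModel {S : Signature.{u}} {Δ : Type v} (M D : DBInstance S Δ) (T : RuleSet S Δ) : Prop :=
  D ⊆ M ∧ ∀ r ∈ T, r.Holds M

/-- `T, D ⊨ Φ`: the query is true in all, finite and infinite, models of `D` and `T`. -/
def Entails {S : Signature.{u}} {Δ : Type v} (T : RuleSet S Δ) (D : DBInstance S Δ)
    (Φ : ConjQuery S Δ) : Prop :=
  ∀ M : DBInstance S Δ, IsModel M D T → Φ.Holds M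

/-- The Bounded Derivation Depth property: every conjunctive query has a rewriting which is a
union of conjunctive queries and is correct on every (finite) database instance. -/
def IsBDD {S : Signature.{u}} {Δ : Type v} (T : RuleSet S Δ) : Prop :=
  ∀ Φ : ConjQuery S Δ, ∃ U : UnionQuery S Δ,
    ∀ D : DBInstance S Δ, D.Finite → (Entails T D Φ ↔ U.Holds D)

/-- Finite controllability: a conjunctive query which is not entailed by `T` and a (finite)
database instance `D` is false in some finite model of `D` and `T`. -/
def IsFC {S : Signature.{u}} {Δ : Type v} (T : RuleSet S Δ) : Prop :=
  ∀ D : DBInstance S Δ, D.Finite → ∀ Φ : ConjQuery S Δ, ¬ Entails T D Φ →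
    ∃ M : DBInstance S Δ, M.Finite ∧ IsModel M D T ∧ ¬ Φ.Holds M

end DatalogEx

/-! Fold the forest of chase terms into a finite set and close the result under the datalog rules;
the rewritings guarantee that nothing harmful becomes true. In a binary signature the head of an
existential rule has at most one position besides the witness, so unary Skolem functions suffice.
The `skeleton` (the facts of `D` and the existential heads created in the chase) is then a forest
whose extra relations, those of `D`, live on the named constants. Identify terms with the same
`nodeType` of depth `2 * K + 2`, where labels record the outermost symbol and the depth modulo `K +
1`. The quotient is finite and keeps the constants apart; its datalog closure is the required model.
The key transfer is `exists_satBy_chase`. A query true in the closure has a disjunct of its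
rewriting true in the quotient itself (`IsRewriting.exists_satBy`). That disjunct has at most `K`
terms, so it lifts to the skeleton (`exists_satBy_skeleton`, by `exists_forest_lift`); the chase is
a model, so the query is true in the chase (`IsRewriting.satBy`). `K` depends only on the
rewritings, so it can be fixed before the quotient. Applied to `Φ`, the transfer and universality of
the chase (`Chase.exists_hom`) show that `Φ` stays false. Applied to a rule body with its frontier
element named, it shows that the rule already fires in the chase at an element of similar type,
hence at the original one, so a witness is already in the quotient (`tgd_holdsIn_datalogClosure`).
-/

namespace DatalogEx

/-! ### Atoms, and rules in structures over an arbitrary domain -/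

section Atoms

variable {S : Signature.{u}} {Δ A B E : Type*}

/-- The image of an atom under a map of its arguments. -/
def Atom.map (f : A → B) (α : Atom S A) : Atom S B :=
  ⟨α.pred, fun i => f (α.args i)⟩

theorem Atom.map_congr {f g : A → B} {α : Atom S A} (h : ∀ i, f (α.args i) = g (α.args i)) :
    α.map f = α.map g := by
  simp only [Atom.map, h]

/-- Pairing the arguments replaces heterogeneous equality of argument tuples by pointwise equations.
-/
theorem Atom.exists_zip {α : Atom S A} {β : Atom S B} {f : A → E} {g : B → E}
    (h : α.map f = β.map g) :
    ∃ γ : Atom S (A × B), γ.map Prod.fst = α ∧ γ.map Prod.snd = β ∧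
      ∀ i, f (γ.args i).1 = g (γ.args i).2 := by
  obtain ⟨p, a⟩ := α
  obtain ⟨p', b⟩ := β
  simp only [Atom.map, Atom.mk.injEq] at h
  obtain ⟨rfl, h⟩ := h
  exact ⟨⟨p, fun i => (a i, b i)⟩, rfl, rfl, fun i => congrFun (eq_of_heq h) i⟩

theorem Atom.map_eq_of_map_eq {α : Atom S A} {β : Atom S B} {f : A → E} {g : B → E} {h : A → B}
    (H : α.map f = β.map g) (hfg : ∀ a b, f a = g b → h a = b) : α.map h = β := by
  obtain ⟨γ, rfl, rfl, hγ⟩ := Atom.exists_zip H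
  exact Atom.map_congr (f := fun x : A × B => h x.1) fun i => hfg _ _ (hγ i)

instance [Finite S.Pred] [Finite A] : Finite (Atom S A) :=
  Finite.of_injective (β := Σ p : S.Pred, (Fin (S.arity p) → A)) (fun α => ⟨α.pred, α.args⟩)
    fun α β h => by
      obtain ⟨p, a⟩ := α
      obtain ⟨p', b⟩ := β
      simp only [Sigma.mk.injEq] at h
      simpa only [Atom.mk.injEq] using h

/-- The constants of an atom. -/
def Atom.consts (α : Atom S (Term Δ)) : Set Δ := {c | ∃ i, α.args i = .const c}

/-- The constants of a query. -/
def ConjQuery.consts (Φ : ConjQuery S Δ) : Set Δ := {c | ∃ α ∈ Φ, c ∈ α.consts}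

/-- The terms of a query. -/
def ConjQuery.terms (Φ : ConjQuery S Δ) : Set (Term Δ) := {t | ∃ α ∈ Φ, ∃ i, α.args i = t}

/-- The constants of a rule. -/
def Rule.consts : Rule S Δ → Set Δ
  | .datalog body head _ => ConjQuery.consts body ∪ head.consts
  | .tgd body _ head _ _ _ _ => ConjQuery.consts body ∪ head.consts

theorem ConjQuery.finite_terms (Φ : ConjQuery S Δ) : Φ.terms.Finite := by
  have : Φ.terms = ⋃ α ∈ {α | α ∈ Φ}, Set.range α.args := by
    ext t; simp [ConjQuery.terms]
  rw [this]
  exact (List.finite_toSet Φ).biUnion fun α _ => Set.finite_range _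

theorem ConjQuery.finite_consts (Φ : ConjQuery S Δ) : Φ.consts.Finite := by
  refine (Φ.finite_terms.preimage (f := Term.const) ?_).subset ?_
  · intro a _ b _ h
    simpa using h
  · rintro c ⟨α, hα, i, hi⟩
    exact ⟨α, hα, i, hi⟩

theorem Atom.finite_consts (α : Atom S (Term Δ)) : α.consts.Finite := by
  refine (ConjQuery.finite_consts [α]).subset fun c hc => ?_
  exact ⟨α, by simp, hc⟩

theorem Rule.finite_consts (r : Rule S Δ) : r.consts.Finite := by
  cases r <;> exact (ConjQuery.finite_consts _).union (Atom.finite_consts _)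

/-- All atoms of `Φ` are true in `X` under the interpretation `f` of the terms. -/
def ConjQuery.SatBy (Φ : ConjQuery S Δ) (X : Set (Atom S A)) (f : Term Δ → A) : Prop :=
  ∀ α ∈ Φ, α.map f ∈ X

/-- On the set `C`, the interpretation `f` of the terms extends the interpretation `κ` of the
constants. -/
def Interprets (κ : Δ → A) (C : Set Δ) (f : Term Δ → A) : Prop :=
  ∀ c ∈ C, f (.const c) = κ c

/-- The rule is true in a structure over `A` whose constants are interpreted by `κ`. -/
def Rule.HoldsIn (κ : Δ → A) (C : Set Δ) (X : Set (Atom S A)) : Rule S Δ → Prop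
  | .datalog body head _ => ∀ f, Interprets κ C f → ConjQuery.SatBy body X f → head.map f ∈ X
  | .tgd body _ head pos _ _ _ => ∀ f, Interprets κ C f → ConjQuery.SatBy body X f →
      ∃ a, (⟨head.pred, fun i => if i = pos then a else f (head.args i)⟩ : Atom S A) ∈ X

theorem Atom.map_map_eq_ground {κ : Δ → A} {C : Set Δ} {f : Term Δ → A} {e : A → Δ}
    {α : Atom S (Term Δ)} (hα : α.consts ⊆ C) (hf : Interprets κ C f)
    (he : ∀ c ∈ C, e (κ c) = c) : (α.map f).map e = α.ground fun x => e (f (.var x)) := by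
  refine Atom.map_congr (f := fun t => e (f t)) (g := Term.eval fun x => e (f (.var x))) fun i => ?_
  cases h : α.args i with
  | const c => simp only [Term.eval, hf c (hα ⟨i, h⟩), he c (hα ⟨i, h⟩)]
  | var x => rfl

theorem Atom.map_invFun_mem [Nonempty A] {e : A → Δ} (he : e.Injective) {X : Set (Atom S A)}
    {α : Atom S (Term Δ)} {ν : ℕ → Δ} (h : α.ground ν ∈ Atom.map e '' X) :
    α.map (fun t => Function.invFun e (t.eval ν)) ∈ X := by
  obtain ⟨β, hβ, h⟩ := h
  have h' : α.map (Term.eval ν) = β.map e := h.symm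
  rw [Atom.map_eq_of_map_eq h' (h := fun t => Function.invFun e (t.eval ν))]
  · exact hβ
  · intro a b hab
    rw [hab, Function.leftInverse_invFun he]

theorem Atom.eval_mem_range {e : A → Δ} {X : Set (Atom S A)} {α : Atom S (Term Δ)} {ν : ℕ → Δ}
    (h : α.ground ν ∈ Atom.map e '' X) (i) : (α.args i).eval ν ∈ Set.range e := by
  obtain ⟨β, -, h⟩ := h
  have h' : α.map (Term.eval ν) = β.map e := h.symm
  obtain ⟨γ, rfl, rfl, hγ⟩ := Atom.exists_zip h'
  exact ⟨_, (hγ i).symm⟩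

theorem ConjQuery.HoldsAt.var_mem_range {e : A → Δ} {X : Set (Atom S A)} {Φ : ConjQuery S Δ}
    {ν : ℕ → Δ} (h : Φ.HoldsAt (Atom.map e '' X) ν) {x : ℕ} (hx : Φ.HasVar x) :
    ν x ∈ Set.range e := by
  obtain ⟨α, hα, i, hi⟩ := hx
  have := Atom.eval_mem_range (h α hα) i
  rwa [hi] at this

theorem interprets_invFun [Nonempty A] {e : A → Δ} (he : e.Injective) {κ : Δ → A} {C : Set Δ}
    (hκ : ∀ c ∈ C, e (κ c) = c) (ν : ℕ → Δ) :
    Interprets κ C fun t => Function.invFun e (t.eval ν) := by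
  intro c hc
  refine he ?_
  rw [hκ c hc]
  exact Function.invFun_eq ⟨κ c, hκ c hc⟩

/-- A valuation in the image is pulled back along the inverse of `e`. Values outside the range of
`e` do no harm: by safety, head variables other than the witness occur in the body, whose facts lie
in the image. -/
theorem Rule.HoldsIn.holds_image [Nonempty A] {e : A → Δ} (he : e.Injective) {κ : Δ → A}
    {C : Set Δ} (hκ : ∀ c ∈ C, e (κ c) = c) {X : Set (Atom S A)} {r : Rule S Δ}
    (hC : r.consts ⊆ C) (h : r.HoldsIn κ C X) : r.Holds (Atom.map e '' X) := by
  have key : ∀ (ν : ℕ → Δ) (t : Term Δ), (∀ c, t = .const c → c ∈ C) →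
      (∀ x, t = .var x → ν x ∈ Set.range e) → e (Function.invFun e (t.eval ν)) = t.eval ν := by
    intro ν t hc hv
    refine Function.invFun_eq ?_
    cases t with
    | const c => exact ⟨κ c, hκ c (hc c rfl)⟩
    | var x => exact hv x rfl
  cases r with
  | datalog body head safe =>
    intro ν hν
    refine ⟨_, h _ (interprets_invFun he hκ ν) fun α hα => Atom.map_invFun_mem he (hν α hα), ?_⟩
    refine Atom.map_congr (f := fun t => e (Function.invFun e (t.eval ν))) fun i =>
      key ν _ (fun c hc => hC (Or.inr ⟨i, hc⟩)) fun x hx => ?_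
    exact hν.var_mem_range (safe x ⟨i, hx⟩)
  | tgd body z head pos fresh witness safe =>
    intro ν hν
    obtain ⟨a, ha⟩ := h _ (interprets_invFun he hκ ν) fun α hα => Atom.map_invFun_mem he (hν α hα)
    refine ⟨e a, _, ha, ?_⟩
    simp only [Atom.map, Atom.ground, Atom.mk.injEq, heq_eq_eq, true_and]
    funext i
    by_cases hi : i = pos
    · subst hi
      simp [witness, Term.eval]
    · simp only [if_neg hi]
      rw [key ν _ (fun c hc => hC (Or.inr ⟨i, hc⟩)) fun x hx => hν.var_mem_range (safe i hi x hx)]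
      cases hx : head.args i with
      | const c => rfl
      | var x =>
        have : x ≠ z := fun h => fresh (h ▸ safe i hi x hx)
        simp [Term.eval, Function.update_of_ne this]

end Atoms

/-! ### Rewritings evaluated in abstract structures -/

section Rewriting

variable {S : Signature.{u}} {Δ : Type v} {A : Type w}

/-- Realizes an abstract structure as a database instance. Unnamed elements go to constants outside
`F ∪ C`, so they cannot be mistaken for a constant that a query mentions. -/
theorem exists_injective_extension [Infinite Δ] [Countable A] {κ : Δ → A} {C F : Set Δ}
    (hC : C.Finite) (hF : F.Finite) (hκ : Set.InjOn κ C) :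
    ∃ e : A → Δ, e.Injective ∧ (∀ c ∈ C, e (κ c) = c) ∧ ∀ a, e a ∈ F → e a ∈ C := by
  classical
  have hinf : ((F ∪ C)ᶜ : Set Δ).Infinite := (hF.union hC).infinite_compl
  have := hinf.to_subtype
  obtain ⟨i, hi⟩ := exists_injective_nat A
  let j : A → Δ := fun a => (Infinite.natEmbedding ((F ∪ C)ᶜ : Set Δ) (i a) : Δ)
  have hj : j.Injective := fun a b h =>
    hi ((Infinite.natEmbedding _).injective (Subtype.ext h))
  have hjn : ∀ a, j a ∉ F ∪ C := fun a => (Infinite.natEmbedding ((F ∪ C)ᶜ : Set Δ) (i a)).2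
  let e : A → Δ := fun a => if h : ∃ c ∈ C, κ c = a then h.choose else j a
  have h1 : ∀ c ∈ C, e (κ c) = c := by
    intro c hc
    have h : ∃ c' ∈ C, κ c' = κ c := ⟨c, hc, rfl⟩
    simp only [e, dif_pos h]
    exact hκ h.choose_spec.1 hc h.choose_spec.2
  have h2 : ∀ a, (¬ ∃ c ∈ C, κ c = a) → e a = j a := fun a h => dif_neg h
  refine ⟨e, ?_, h1, ?_⟩
  · intro a b hab
    by_cases ha : ∃ c ∈ C, κ c = a
    · obtain ⟨c, hc, rfl⟩ := ha
      by_cases hb : ∃ c ∈ C, κ c = b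
      · obtain ⟨c', hc', rfl⟩ := hb
        rw [h1 c hc, h1 c' hc'] at hab
        rw [hab]
      · rw [h1 c hc, h2 b hb] at hab
        exact (hjn b (Or.inr (hab ▸ hc))).elim
    · by_cases hb : ∃ c ∈ C, κ c = b
      · obtain ⟨c', hc', rfl⟩ := hb
        rw [h1 c' hc', h2 a ha] at hab
        exact (hjn a (Or.inr (hab ▸ hc'))).elim
      · rw [h2 a ha, h2 b hb] at hab
        exact hj hab
  · intro a ha
    by_cases h : ∃ c ∈ C, κ c = a
    · obtain ⟨c, hc, rfl⟩ := h
      rwa [h1 c hc]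
    · rw [h2 a h] at ha
      exact (hjn a (Or.inl ha)).elim

/-- The closure of a set of facts under the datalog rules of `T`. -/
inductive DatalogClosure (T : RuleSet S Δ) (κ : Δ → A) (C : Set Δ) (X : Set (Atom S A)) :
    Atom S A → Prop
  | base {α} (h : α ∈ X) : DatalogClosure T κ C X α
  | datalog {body head safe} (h : Rule.datalog body head safe ∈ T) (f : Term Δ → A)
      (hf : Interprets κ C f) (hb : ∀ α ∈ body, DatalogClosure T κ C X (α.map f)) :
      DatalogClosure T κ C X (head.map f)

/-- `U` is a rewriting of `Φ`. -/
def IsRewriting (T : RuleSet S Δ) (Φ : ConjQuery S Δ) (U : UnionQuery S Δ) : Prop :=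
  ∀ D : DBInstance S Δ, D.Finite → (Entails T D Φ ↔ U.Holds D)

variable {T : RuleSet S Δ} {κ κ' : Δ → A} {C C' : Set Δ}

theorem DatalogClosure.map_mem {X : Set (Atom S A)} {e : A → Δ} (hT : ∀ r ∈ T, r.consts ⊆ C)
    (hκ : ∀ c ∈ C, e (κ c) = c) {M : DBInstance S Δ} (hM : IsModel M (Atom.map e '' X) T)
    {α : Atom S A} (h : DatalogClosure T κ C X α) : α.map e ∈ M := by
  induction h with
  | base h => exact hM.1 ⟨_, h, rfl⟩
  | @datalog body head safe h f hf _ ih =>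
    have hr := hM.2 _ h
    rw [Atom.map_map_eq_ground (fun c hc => hT _ h (Or.inr hc)) hf hκ]
    refine hr _ fun α hα => ?_
    rw [← Atom.map_map_eq_ground (fun c hc => hT _ h (Or.inl ⟨α, hα, hc⟩)) hf hκ]
    exact ih α hα

/-- A query which is true in the datalog closure of a finite structure has a disjunct of its
rewriting true in the structure itself. -/
theorem IsRewriting.exists_satBy [Infinite Δ] [Countable A] [Nonempty A] {Φ : ConjQuery S Δ}
    {U : UnionQuery S Δ} (hU : IsRewriting T Φ U) (hT : ∀ r ∈ T, r.consts ⊆ C)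
    {X : Set (Atom S A)} (hX : X.Finite) (hC' : C'.Finite) (hκ' : Set.InjOn κ' C')
    (hCC : C ⊆ C') (hκκ : ∀ c ∈ C, κ' c = κ c) (hΦ : Φ.consts ⊆ C') {f : Term Δ → A}
    (hf : Interprets κ' C' f) (h : Φ.SatBy {α | DatalogClosure T κ C X α} f) :
    ∃ Ψ ∈ U, ConjQuery.consts Ψ ⊆ C' ∧ ∃ g, Interprets κ' C' g ∧ ConjQuery.SatBy Ψ X g := by
  have hF : (⋃ Ψ ∈ {Ψ | Ψ ∈ U}, ConjQuery.consts Ψ).Finite :=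
    (List.finite_toSet U).biUnion fun Ψ _ => ConjQuery.finite_consts Ψ
  -- The set avoided consists of the constants of the rewriting, so a disjunct true in the image can
  -- mention only constants of `C'`.
  obtain ⟨e, he, heκ, heF⟩ := exists_injective_extension hC' hF hκ'
  have heκ0 : ∀ c ∈ C, e (κ c) = c := fun c hc => by rw [← hκκ c hc, heκ c (hCC hc)]
  have hent : Entails T (Atom.map e '' X) Φ := by
    intro M hM
    refine ⟨fun x => e (f (.var x)), fun α hα => ?_⟩
    rw [← Atom.map_map_eq_ground (fun c hc => hΦ ⟨α, hα, hc⟩) hf heκ]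
    exact DatalogClosure.map_mem hT heκ0 hM (h α hα)
  obtain ⟨Ψ, hΨU, ν, hν⟩ := (hU _ (hX.image _)).1 hent
  refine ⟨Ψ, hΨU, ?_, _, interprets_invFun he heκ ν, fun α hα => Atom.map_invFun_mem he (hν α hα)⟩
  rintro c ⟨α, hα, i, hi⟩
  have hr := Atom.eval_mem_range (hν α hα) i
  rw [hi] at hr
  obtain ⟨a, ha⟩ := hr
  simp only [Term.eval] at ha
  rw [← ha]
  refine heF a (Set.mem_biUnion (show Ψ ∈ {Ψ | Ψ ∈ U} from hΨU) ?_)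
  rw [ha]
  exact ⟨α, hα, i, hi⟩

/-- A query with a disjunct of its rewriting true in a model of the rules is true in the model. -/
theorem IsRewriting.satBy [Infinite Δ] [Countable A] [Nonempty A] {Φ : ConjQuery S Δ}
    {U : UnionQuery S Δ} (hU : IsRewriting T Φ U) (hT : ∀ r ∈ T, r.consts ⊆ C)
    {X : Set (Atom S A)} (hX : ∀ r ∈ T, r.HoldsIn κ C X) (hC' : C'.Finite)
    (hκ' : Set.InjOn κ' C') (hCC : C ⊆ C') (hκκ : ∀ c ∈ C, κ' c = κ c) {Ψ : ConjQuery S Δ}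
    (hΨU : Ψ ∈ U) (hΨ : Ψ.consts ⊆ C') {g : Term Δ → A} (hg : Interprets κ' C' g)
    (h : Ψ.SatBy X g) : ∃ f, Interprets κ' C' f ∧ Φ.SatBy X f := by
  obtain ⟨e, he, heκ, -⟩ := exists_injective_extension hC' Set.finite_empty hκ'
  have heκ0 : ∀ c ∈ C, e (κ c) = c := fun c hc => by rw [← hκκ c hc, heκ c (hCC hc)]
  -- Rewritings are correct only on finite instances and `X` may be infinite, so only the matched
  -- atoms are taken as the database.
  have hfin : (Atom.map e '' (Atom.map g '' {α | α ∈ Ψ})).Finite :=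
    ((List.finite_toSet Ψ).image _).image _
  have hent : Entails T (Atom.map e '' (Atom.map g '' {α | α ∈ Ψ})) Φ := by
    refine (hU _ hfin).2 ⟨Ψ, hΨU, fun x => e (g (.var x)), fun α hα => ?_⟩
    rw [← Atom.map_map_eq_ground (fun c hc => hΨ ⟨α, hα, hc⟩) hg heκ]
    exact ⟨_, ⟨α, hα, rfl⟩, rfl⟩
  obtain ⟨ν, hν⟩ := hent (Atom.map e '' X)
    ⟨Set.image_mono (by rintro _ ⟨α, hα, rfl⟩; exact h α hα),
      fun r hr => (hX r hr).holds_image he heκ0 (hT r hr)⟩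
  exact ⟨_, interprets_invFun he heκ ν, fun α hα => Atom.map_invFun_mem he (hν α hα)⟩

end Rewriting

/-! ### Types in forests and lifting of parent constraints -/

section Forest

variable {N : Type v} {L : Type u} (par : N → Option N) (lab : N → L)

/-- The possible types of depth `n` of the nodes of a forest with labels in `L`. -/
def ForestType (L : Type u) : ℕ → Type u
  | 0 => L
  | n + 1 => ForestType L n × Option (ForestType L n) × Set (ForestType L n)

instance ForestType.finite [Finite L] : ∀ n, Finite (ForestType L n)
  | 0 => inferInstanceAs (Finite L)
  | n + 1 =>
    have : Finite (ForestType L n) := ForestType.finite n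
    inferInstanceAs (Finite (ForestType L n × Option (ForestType L n) × Set (ForestType L n)))

/-- The type of depth `n` of a node: its label, the types of depth `n - 1` of the node and its
parent, and the set of the types of depth `n - 1` of its children. -/
def nodeType : ∀ n, N → ForestType L n
  | 0, x => lab x
  | n + 1, x => (nodeType n x, (par x).map (nodeType n), nodeType n '' {y | par y = some x})

variable {par lab}

theorem nodeType_eq_of_le {m n : ℕ} (hmn : m ≤ n) {x y : N}
    (h : nodeType par lab n x = nodeType par lab n y) :
    nodeType par lab m x = nodeType par lab m y := by
  induction n, hmn using Nat.le_induction with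
  | base => exact h
  | succ n _ ih => exact ih (congrArg Prod.fst h)

theorem lab_eq_of_nodeType_eq {n : ℕ} {x y : N}
    (h : nodeType par lab n x = nodeType par lab n y) : lab x = lab y :=
  nodeType_eq_of_le (Nat.zero_le n) h

theorem exists_parent_of_nodeType_eq {n : ℕ} {x y p : N}
    (h : nodeType par lab (n + 1) x = nodeType par lab (n + 1) y) (hp : par x = some p) :
    ∃ p', par y = some p' ∧ nodeType par lab n p = nodeType par lab n p' := by
  have h2 : (par x).map (nodeType par lab n) = (par y).map (nodeType par lab n) :=
    congrArg (fun t => t.2.1) h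
  rw [hp, Option.map_some, eq_comm, Option.map_eq_some_iff] at h2
  obtain ⟨p', h1, h2⟩ := h2
  exact ⟨p', h1, h2.symm⟩

theorem exists_child_of_nodeType_eq {n : ℕ} {x y c : N}
    (h : nodeType par lab (n + 1) x = nodeType par lab (n + 1) y) (hc : par c = some x) :
    ∃ c', par c' = some y ∧ nodeType par lab n c' = nodeType par lab n c := by
  have h2 : nodeType par lab n '' {z | par z = some x} = nodeType par lab n '' {z | par z = some y} :=
    congrArg (fun t => t.2.2) h
  have : nodeType par lab n c ∈ nodeType par lab n '' {z | par z = some x} := ⟨c, hc, rfl⟩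
  rw [h2] at this
  exact this

/-- Without a sink, a walk in `W` would visit `m` vertices with distinct levels modulo `m`, more
than `W` has. Cyclic levels thus exclude short cycles. -/
theorem exists_sink {V : Type*} {m : ℕ} {lev : V → ZMod m} {E : V → V → Prop} {W : Finset V}
    (hW : W.Nonempty) (hm : W.card < m)
    (hE : ∀ u ∈ W, ∀ v ∈ W, E u v → lev v = lev u + 1) : ∃ v ∈ W, ∀ w ∈ W, ¬ E v w := by
  by_contra! hno
  choose s hsW hsE using hno
  obtain ⟨v₀, hv₀⟩ := hW
  let f : ℕ → {v // v ∈ W} := fun i => Nat.rec ⟨v₀, hv₀⟩ (fun _ v => ⟨s v v.2, hsW v v.2⟩) i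
  have hlev : ∀ i, lev (f i).1 = lev v₀ + i := by
    intro i
    induction i with
    | zero => simp [f]
    | succ i ih =>
      have h := hE (f i).1 (f i).2 (f (i + 1)).1 (f (i + 1)).2 (hsE _ (f i).2)
      rw [h, ih]
      push_cast
      ring
  have hinj : Function.Injective fun i : Fin m => f i := by
    intro i j hij
    have h : lev (f i).1 = lev (f j).1 := by rw [show f i = f j from hij]
    rw [hlev, hlev, add_right_inj, ZMod.natCast_eq_natCast_iff] at h
    exact Fin.ext (Nat.ModEq.eq_of_lt_of_lt h i.2 j.2)
  have := Fintype.card_le_of_injective _ hinj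
  simp only [Fintype.card_fin, Fintype.card_coe] at this
  omega

/-- A system of parent constraints which is satisfied up to types of a sufficient depth can be
satisfied exactly, with a loss of precision. -/
theorem exists_forest_lift {V : Type*} {m : ℕ} {lev : L → ZMod m}
    (hlev : ∀ x y, par y = some x → lev (lab y) = lev (lab x) + 1) (k : ℕ) (hk : k < m) :
    ∀ (n : ℕ) (W : Finset V), W.card = k → ∀ (x : V → N) (E : V → V → Prop),
      (∀ u ∈ W, ∀ v ∈ W, E u v → ∃ p, par (x v) = some p ∧
        nodeType par lab (n + 2 * k) p = nodeType par lab (n + 2 * k) (x u)) →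
      ∃ g : V → N, (∀ u ∈ W, ∀ v ∈ W, E u v → par (g v) = some (g u)) ∧
        ∀ v ∈ W, nodeType par lab n (g v) = nodeType par lab n (x v) := by
  classical
  induction k with
  | zero =>
    intro n W hW x E _
    rw [Finset.card_eq_zero] at hW
    subst hW
    exact ⟨x, by simp, by simp⟩
  | succ k ih =>
    intro n W hW x E hE
    obtain ⟨v, hv, hsink⟩ := exists_sink (lev := fun u => lev (lab (x u))) (E := E) (W := W)
      (Finset.card_pos.1 (by omega)) (by omega) (by
        intro u hu v hv huv
        obtain ⟨p, hp, hpu⟩ := hE u hu v hv huv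
        simp only [hlev _ _ hp, lab_eq_of_nodeType_eq hpu])
    have hW' : (W.erase v).card = k := by rw [Finset.card_erase_of_mem hv]; omega
    -- Each removed vertex costs two units of depth: one for merging its predecessors, one for
    -- reattaching it as a child.
    have hn : n + 2 * (k + 1) = n + 1 + 2 * k + 1 := by ring
    rw [hn] at hE
    by_cases hu : ∃ u ∈ W, E u v
    · obtain ⟨u₀, hu₀, hE₀⟩ := hu
      obtain ⟨p, hp, hpu₀⟩ := hE u₀ hu₀ v hv hE₀
      have hu₀v : u₀ ≠ v := fun h => hsink v hv (h ▸ hE₀)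
      -- All predecessors of the sink must become its unique parent, and all have the type of `p`;
      -- they are merged into `u₀` before the induction hypothesis is used.
      let ρ : V → V := fun w => if E w v then u₀ else w
      have hρW : ∀ w ∈ W.erase v, ρ w ∈ W.erase v := by
        intro w hw
        by_cases h : E w v
        · simp only [ρ, if_pos h, Finset.mem_erase]
          exact ⟨hu₀v, hu₀⟩
        · simpa only [ρ, if_neg h] using hw
      have hρ : ∀ w ∈ W, nodeType par lab (n + 1 + 2 * k + 1) (x (ρ w)) =
          nodeType par lab (n + 1 + 2 * k + 1) (x w) := by
        intro w hw
        by_cases h : E w v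
        · obtain ⟨p', hp', hpw⟩ := hE w hw v hv h
          obtain rfl : p = p' := by rw [hp] at hp'; exact Option.some_injective _ hp'
          simp only [ρ, if_pos h]
          rw [← hpu₀, hpw]
        · simp only [ρ, if_neg h]
      obtain ⟨g, hgE, hg⟩ := ih (by omega) (n + 1) (W.erase v) hW' x
        (fun a b => ∃ a' ∈ W, ∃ b' ∈ W, ρ a' = a ∧ ρ b' = b ∧ E a' b') (by
          rintro a - b - ⟨a', ha', b', hb', rfl, rfl, hab⟩
          obtain ⟨q, hq, hqa⟩ := hE a' ha' b' hb' hab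
          obtain ⟨q', hq', hqq⟩ := exists_parent_of_nodeType_eq (hρ b' hb').symm hq
          refine ⟨q', hq', ?_⟩
          rw [← hqq]
          exact nodeType_eq_of_le (Nat.le_succ _) (hqa.trans (hρ a' ha').symm))
      have hu₀' : u₀ ∈ W.erase v := Finset.mem_erase.2 ⟨hu₀v, hu₀⟩
      have hpg : nodeType par lab (n + 1) p = nodeType par lab (n + 1) (g u₀) :=
        (nodeType_eq_of_le (by omega) hpu₀).trans (hg u₀ hu₀').symm
      -- The lifted `u₀` resembles the parent of `x v`, so it has a child resembling `x v`; as a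
      -- sink, `v` imposes nothing more.
      obtain ⟨y, hy, hyv⟩ := exists_child_of_nodeType_eq hpg hp
      refine ⟨fun w => if w = v then y else g (ρ w), ?_, ?_⟩
      · intro a ha b hb hab
        have hav : a ≠ v := fun h => hsink b hb (h ▸ hab)
        have ha' := hρW a (Finset.mem_erase.2 ⟨hav, ha⟩)
        by_cases hbv : b = v
        · subst hbv
          simp only [if_true, if_neg hav]
          rw [hy]
          simp only [ρ, if_pos hab]
        · simp only [if_neg hav, if_neg hbv]
          exact hgE _ ha' _ (hρW b (Finset.mem_erase.2 ⟨hbv, hb⟩)) ⟨a, ha, b, hb, rfl, rfl, hab⟩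
      · intro w hw
        by_cases hwv : w = v
        · subst hwv
          simpa only [if_true] using hyv
        · simp only [if_neg hwv]
          exact (nodeType_eq_of_le (Nat.le_succ _) (hg _ (hρW w (Finset.mem_erase.2 ⟨hwv, hw⟩)))).trans
            (nodeType_eq_of_le (by omega) (hρ w hw))
    · push Not at hu
      obtain ⟨g, hgE, hg⟩ := ih (by omega) (n + 1) (W.erase v) hW' x E (by
        intro a ha b hb hab
        obtain ⟨q, hq, hqa⟩ := hE a (Finset.mem_of_mem_erase ha) b (Finset.mem_of_mem_erase hb) hab
        exact ⟨q, hq, nodeType_eq_of_le (Nat.le_succ _) hqa⟩)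
      refine ⟨fun w => if w = v then x v else g w, ?_, ?_⟩
      · intro a ha b hb hab
        have hav : a ≠ v := fun h => hsink b hb (h ▸ hab)
        have hbv : b ≠ v := fun h => hu a ha (h ▸ hab)
        simp only [if_neg hav, if_neg hbv]
        exact hgE a (Finset.mem_erase.2 ⟨hav, ha⟩) b (Finset.mem_erase.2 ⟨hbv, hb⟩) hab
      · intro w hw
        by_cases hwv : w = v
        · subst hwv
          simp only [if_true]
        · simp only [if_neg hwv]
          exact nodeType_eq_of_le (Nat.le_succ _) (hg w (Finset.mem_erase.2 ⟨hwv, hw⟩))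

end Forest

/-! ### The Skolem chase and its skeleton -/

section Chase

variable {S : Signature.{u}} {Δ : Type v} {A B : Type*}

/-- The rule is existential, and its body is true in `X` at a valuation which sends all positions
of the head, except for the existentially quantified one, to `t`. -/
def Rule.Fires (κ : Δ → A) (C : Set Δ) (X : Set (Atom S A)) (t : A) : Rule S Δ → Prop
  | .datalog _ _ _ => False
  | .tgd body _ head pos _ _ _ => ∃ f, Interprets κ C f ∧ ConjQuery.SatBy body X f ∧
      ∀ i, i ≠ pos → f (head.args i) = t

/-- The head of an existential rule with `c` as the witness and `p` at the other positions. -/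
def Rule.headFact (c p : A) : Rule S Δ → Atom S A
  | .datalog _ head _ => ⟨head.pred, fun _ => c⟩
  | .tgd _ _ head pos _ _ _ => ⟨head.pred, fun i => if i = pos then c else p⟩

/-- Binarity makes a single frontier element enough. For a unary symbol there is no other position
and `t` is arbitrary. -/
theorem Signature.IsBinary.exists_eq_of_ne (hS : S.IsBinary) [Nonempty A] {p : S.Pred}
    (pos : Fin (S.arity p)) (a : Fin (S.arity p) → A) : ∃ t, ∀ i, i ≠ pos → a i = t := by
  by_cases h : ∃ j, j ≠ pos
  · obtain ⟨j, hj⟩ := h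
    refine ⟨a j, fun i hi => ?_⟩
    have hij : i = j := by
      rw [Ne, Fin.ext_iff] at hi hj
      ext
      rcases hS p with h | h <;> omega
    rw [hij]
  · push Not at h
    exact ⟨Classical.arbitrary A, fun i hi => (hi (h i)).elim⟩

/-- Ground Skolem terms: iterated applications of Skolem functions, one for each rule, to a
constant. -/
abbrev ChaseTerm (C : Set Δ) (T : RuleSet S Δ) := C × List T

variable {C : Set Δ} {T : RuleSet S Δ}

/-- The application of the Skolem function of a rule. -/
def ChaseTerm.child (r : T) (t : ChaseTerm C T) : ChaseTerm C T := (t.1, r :: t.2)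

/-- The facts of the Skolem chase. -/
inductive Chase (κ : Δ → ChaseTerm C T) (D : DBInstance S Δ) : Atom S (ChaseTerm C T) → Prop
  | base {α} (h : α ∈ D) : Chase κ D (α.map κ)
  | datalog {body head safe} (h : Rule.datalog body head safe ∈ T) (f : Term Δ → ChaseTerm C T)
      (hf : Interprets κ C f) (hb : ∀ α ∈ body, Chase κ D (α.map f)) : Chase κ D (head.map f)
  | tgd {body z head pos fresh witness safe}
      (h : Rule.tgd body z head pos fresh witness safe ∈ T) (f : Term Δ → ChaseTerm C T)
      (hf : Interprets κ C f) (hb : ∀ α ∈ body, Chase κ D (α.map f)) (t : ChaseTerm C T)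
      (ht : ∀ i, i ≠ pos → f (head.args i) = t) :
      Chase κ D ⟨head.pred, fun i => if i = pos then ChaseTerm.child ⟨_, h⟩ t else t⟩

variable {κ : Δ → ChaseTerm C T} {D : DBInstance S Δ}

theorem Chase.headFact {r : T} {t : ChaseTerm C T}
    (h : r.1.Fires κ C {α | Chase κ D α} t) : Chase κ D (r.1.headFact (ChaseTerm.child r t) t) := by
  obtain ⟨r, hr⟩ := r
  cases r with
  | datalog => exact h.elim
  | tgd body z head pos fresh witness safe =>
    obtain ⟨f, hf, hb, ht⟩ := h
    exact Chase.tgd hr f hf hb t ht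

theorem Chase.holdsIn (hS : S.IsBinary) [Nonempty C] {r : Rule S Δ} (hr : r ∈ T) :
    r.HoldsIn κ C {α | Chase κ D α} := by
  cases r with
  | datalog => exact fun f hf hb => Chase.datalog hr f hf hb
  | tgd body z head pos fresh witness safe =>
    intro f hf hb
    obtain ⟨t, ht⟩ := hS.exists_eq_of_ne pos fun i => f (head.args i)
    refine ⟨ChaseTerm.child ⟨_, hr⟩ t, ?_⟩
    have h := Chase.tgd hr f hf hb t ht
    change Chase κ D _
    convert h using 3 with i
    split_ifs with hi
    · rfl
    · exact ht i hi

theorem Rule.Holds.exists_headFact_mem {M : DBInstance S Δ} {r : Rule S Δ} (h : r.Holds M)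
    (hC : r.consts ⊆ C) {d : Δ} (hd : r.Fires id C M d) : ∃ c, r.headFact c d ∈ M := by
  cases r with
  | datalog => exact hd.elim
  | tgd body z head pos fresh witness safe =>
    obtain ⟨f, hf, hb, ht⟩ := hd
    obtain ⟨c, hc⟩ := h (fun x => f (.var x)) fun α hα => by
      have := Atom.map_map_eq_ground (e := id) (fun c hc => hC (Or.inl ⟨α, hα, hc⟩)) hf
        fun _ _ => rfl
      simp only [id] at this
      rw [← this]
      exact hb α hα
    refine ⟨c, ?_⟩
    convert hc using 1
    simp only [Rule.headFact, Atom.ground, Atom.mk.injEq, heq_eq_eq, true_and]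
    funext i
    split_ifs with hi
    · subst hi
      simp [witness, Term.eval]
    · rw [← ht i hi]
      cases hx : head.args i with
      | const c => exact hf c (hC (Or.inr ⟨i, hx⟩))
      | var x =>
        have : x ≠ z := fun h => fresh (h ▸ safe i hi x hx)
        simp [Term.eval, Function.update_of_ne this]

/-- The chase is universal. -/
theorem Chase.exists_hom (hκ : ∀ c : C, κ c = (c, [])) (hT : ∀ r ∈ T, r.consts ⊆ C)
    (hD : ∀ α ∈ D, ∀ i, α.args i ∈ C) {M : DBInstance S Δ} (hM : IsModel M D T) :
    ∃ h : ChaseTerm C T → Δ, (∀ c ∈ C, h (κ c) = c) ∧ ∀ α, Chase κ D α → α.map h ∈ M := by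
  -- Skolem functions are interpreted in `M` by chosen witnesses, with a dummy value where the rule
  -- does not fire.
  have hw : ∀ (r : T) (d : Δ), ∃ c, r.1.Fires id C M d → r.1.headFact c d ∈ M := by
    intro r d
    by_cases hd : r.1.Fires id C M d
    · obtain ⟨c, hc⟩ := (hM.2 _ r.2).exists_headFact_mem (hT _ r.2) hd
      exact ⟨c, fun _ => hc⟩
    · exact ⟨d, fun h => (hd h).elim⟩
  choose w hw using hw
  let h : ChaseTerm C T → Δ := fun t => t.2.foldr w t.1
  have hκ' : ∀ c ∈ C, h (κ c) = c := fun c hc => by rw [hκ ⟨c, hc⟩]; rfl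
  refine ⟨h, hκ', fun α hα => ?_⟩
  induction hα with
  | @base α hα =>
    have : (α.map κ).map h = α.map id := Atom.map_congr (f := fun c => h (κ c)) fun i =>
      hκ' _ (hD α hα i)
    rw [this]
    exact hM.1 hα
  | @datalog body head safe hr f hf _ ih =>
    have hr' := hM.2 _ hr
    rw [Atom.map_map_eq_ground (fun c hc => hT _ hr (Or.inr hc)) hf hκ']
    refine hr' _ fun α hα => ?_
    rw [← Atom.map_map_eq_ground (fun c hc => hT _ hr (Or.inl ⟨α, hα, hc⟩)) hf hκ']
    exact ih α hα
  | @tgd body z head pos fresh witness safe hr f hf _ t ht ih =>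
    have := hw ⟨_, hr⟩ (h t) ⟨fun s => h (f s), fun c hc => (congrArg h (hf c hc)).trans (hκ' c hc),
      ih, fun i hi => congrArg h (ht i hi)⟩
    convert this using 1
    simp only [Atom.map, Rule.headFact, Atom.mk.injEq, heq_eq_eq, true_and]
    funext i
    split_ifs <;> rfl

/-- The facts of the database and the heads of the existential rules used in the chase. -/
def skeleton (κ : Δ → ChaseTerm C T) (D : DBInstance S Δ) : Set (Atom S (ChaseTerm C T)) :=
  {α | (∃ β ∈ D, α = β.map κ) ∨ ∃ (r : T) (t : ChaseTerm C T),
    r.1.Fires κ C {α | Chase κ D α} t ∧ α = r.1.headFact (ChaseTerm.child r t) t}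

theorem skeleton_subset_chase : skeleton κ D ⊆ {α | Chase κ D α} := by
  rintro _ (⟨β, hβ, rfl⟩ | ⟨r, t, h, rfl⟩)
  · exact Chase.base hβ
  · exact Chase.headFact h

open Classical in
/-- The parent of a term in the forest of the terms created in the chase. -/
noncomputable def chaseParent (κ : Δ → ChaseTerm C T) (D : DBInstance S Δ) :
    ChaseTerm C T → Option (ChaseTerm C T)
  | (_, []) => none
  | (c, r :: l) => if r.1.Fires κ C {α | Chase κ D α} (c, l) then some (c, l) else none

/-- The outermost symbol of a term. -/
def ChaseTerm.symbol : ChaseTerm C T → C ⊕ T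
  | (c, []) => .inl c
  | (_, r :: _) => .inr r

/-- The outermost symbol of a term and its depth modulo `m`. -/
def ChaseTerm.label (m : ℕ) (t : ChaseTerm C T) : (C ⊕ T) × ZMod m :=
  (t.symbol, t.2.length)

theorem chaseParent_eq_some {x y : ChaseTerm C T} (h : chaseParent κ D x = some y) :
    ∃ r, x = ChaseTerm.child r y ∧ r.1.Fires κ C {α | Chase κ D α} y := by
  obtain ⟨c, _ | ⟨r, l⟩⟩ := x
  · simp [chaseParent] at h
  · simp only [chaseParent, Option.ite_none_right_eq_some, Option.some.injEq] at h
    obtain ⟨h, rfl⟩ := h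
    exact ⟨r, rfl, h⟩

theorem chaseParent_child {r : T} {t : ChaseTerm C T}
    (h : r.1.Fires κ C {α | Chase κ D α} t) :
    chaseParent κ D (ChaseTerm.child r t) = some t := by
  obtain ⟨c, l⟩ := t
  simp [chaseParent, ChaseTerm.child, h]

theorem eq_const_of_label_eq {m : ℕ} (hκ : ∀ c : C, κ c = (c, [])) {x : ChaseTerm C T} {c : Δ}
    (hc : c ∈ C) (h : x.label m = (κ c).label m) : x = κ c := by
  rw [hκ ⟨c, hc⟩] at h ⊢
  obtain ⟨c', _ | ⟨r, l⟩⟩ := x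
  · simp only [ChaseTerm.label, ChaseTerm.symbol, Prod.mk.injEq, Sum.inl.injEq] at h
    rw [h.1]
  · simp [ChaseTerm.label, ChaseTerm.symbol] at h

/-- A term has a parent only if its outermost rule fires there, so the label together with the
existence of a parent certifies the firing. -/
theorem eq_child_of_label_eq {m : ℕ} {x y t : ChaseTerm C T} {r : T}
    (h : x.label m = (ChaseTerm.child r t).label m) (hx : chaseParent κ D x = some y) :
    x = ChaseTerm.child r y ∧ r.1.Fires κ C {α | Chase κ D α} y := by
  obtain ⟨r', rfl, hr'⟩ := chaseParent_eq_some hx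
  simp only [ChaseTerm.label, ChaseTerm.symbol, ChaseTerm.child, Prod.mk.injEq,
    Sum.inr.injEq] at h
  obtain rfl := h.1
  exact ⟨rfl, hr'⟩

theorem label_snd_of_chaseParent {m : ℕ} (x y : ChaseTerm C T)
    (h : chaseParent κ D y = some x) : (y.label m).2 = (x.label m).2 + 1 := by
  obtain ⟨r, rfl, -⟩ := chaseParent_eq_some h
  simp [ChaseTerm.label, ChaseTerm.child]

/-- A small query which is true in a sufficiently precise quotient of the skeleton is true in the
skeleton. -/
theorem exists_satBy_skeleton (hκ : ∀ c : C, κ c = (c, [])) (hD : ∀ α ∈ D, ∀ i, α.args i ∈ C)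
    {K : ℕ} {q : ChaseTerm C T → B}
    (hq : ∀ x y, q x = q y → nodeType (chaseParent κ D) (ChaseTerm.label (K + 1)) (2 * K + 2) x =
      nodeType (chaseParent κ D) (ChaseTerm.label (K + 1)) (2 * K + 2) y)
    {Ψ : ConjQuery S Δ} {W : Finset (Term Δ)} (hΨ : Ψ.terms ⊆ W) (hW : W.card ≤ K)
    {x : Term Δ → ChaseTerm C T} (h : Ψ.SatBy (Atom.map q '' skeleton κ D) fun t => q (x t)) :
    ∃ g, Ψ.SatBy (skeleton κ D) g ∧ ∀ t ∈ W,
      nodeType (chaseParent κ D) (ChaseTerm.label (K + 1)) 1 (g t) =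
        nodeType (chaseParent κ D) (ChaseTerm.label (K + 1)) 1 (x t) := by
  -- All parent relations that hold up to type are imposed as constraints at once. Depth `1` is kept
  -- for the final types.
  obtain ⟨g, hgE, hg⟩ := exists_forest_lift (par := chaseParent κ D)
    (lab := ChaseTerm.label (K + 1)) (lev := Prod.snd) label_snd_of_chaseParent W.card (by omega)
    1 W rfl x (fun u v => ∃ p, chaseParent κ D (x v) = some p ∧
      nodeType (chaseParent κ D) (ChaseTerm.label (K + 1)) (1 + 2 * W.card) p =
        nodeType (chaseParent κ D) (ChaseTerm.label (K + 1)) (1 + 2 * W.card) (x u))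
    fun _ _ _ _ h => h
  refine ⟨g, fun α hα => ?_, hg⟩
  obtain ⟨β, hβ, h⟩ := h α hα
  obtain ⟨γ, rfl, rfl, hγ⟩ := Atom.exists_zip (f := fun t => q (x t)) h.symm
  have hγW : ∀ i, (γ.args i).1 ∈ W := fun i => hΨ ⟨_, hα, i, rfl⟩
  rcases hβ with ⟨δ, hδ, hβ⟩ | ⟨r, t, ht, hβ⟩
  · refine Or.inl ⟨δ, hδ, ?_⟩
    obtain ⟨ε, rfl, rfl, hε⟩ := Atom.exists_zip hβ
    refine Atom.map_congr (f := fun z : (Term Δ × ChaseTerm C T) × Δ => g z.1.1)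
      (g := fun z => κ z.2) fun i => ?_
    refine eq_const_of_label_eq (m := K + 1) hκ (hD _ hδ i) ?_
    refine (lab_eq_of_nodeType_eq (hg _ (hγW i))).trans ?_
    rw [← hε i]
    exact lab_eq_of_nodeType_eq (hq _ _ (hγ i))
  · refine Or.inr ⟨r, ?_⟩
    obtain ⟨r, hr⟩ := r
    cases r with
    | datalog => exact ht.elim
    | tgd body z head pos fresh witness safe =>
      obtain ⟨p, args⟩ := γ
      simp only [Atom.map, Rule.headFact, Atom.mk.injEq] at hβ
      obtain ⟨rfl, hβ⟩ := hβ
      have hβ : ∀ i, (args i).2 = if i = pos then ChaseTerm.child ⟨_, hr⟩ t else t :=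
        fun i => congrFun (eq_of_heq hβ) i
      have hpos := hq _ _ (hγ pos)
      simp only [hβ, if_true] at hpos
      -- The parent of the witness is traced from the quotient to `x`, then to `g`; the label
      -- identifies the rule, and the lifted constraint identifies the parent with the value of the
      -- other argument.
      have hpar := chaseParent_child ht
      obtain ⟨y, hy, hyt⟩ := exists_parent_of_nodeType_eq hpos.symm hpar
      obtain ⟨s, hs, -⟩ := exists_parent_of_nodeType_eq (hg _ (hγW pos)).symm hy
      obtain ⟨hchild, hfires⟩ := eq_child_of_label_eq
        ((lab_eq_of_nodeType_eq (hg _ (hγW pos))).trans (lab_eq_of_nodeType_eq hpos)) hs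
      refine ⟨s, hfires, ?_⟩
      simp only [Atom.map, Rule.headFact, Atom.mk.injEq, heq_eq_eq, true_and]
      funext i
      split_ifs with hi
      · rw [hi, hchild]
      · have hqi := hq _ _ (hγ i)
        simp only [hβ, if_neg hi] at hqi
        have := hgE _ (hγW i) _ (hγW pos) ⟨y, hy, nodeType_eq_of_le (by omega)
          (hyt.symm.trans (nodeType_eq_of_le (by omega) hqi.symm))⟩
        rw [hs] at this
        exact (Option.some_injective _ this).symm

end Chase

/-! ### Rule bodies with a named frontier element -/

section Frontier

variable {S : Signature.{u}} {Δ : Type v} {A : Type*}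

open Classical in
/-- The substitution of the constant `d` for the variables among the terms in `F`. -/
noncomputable def nameVars (F : Set (Term Δ)) (d : Δ) : Term Δ → Term Δ
  | .const c => .const c
  | .var x => if .var x ∈ F then .const d else .var x

/-- The body of an existential rule, with the constant `d` substituted for the variable which it
shares with the head. -/
noncomputable def Rule.frontierQuery (d : Δ) : Rule S Δ → ConjQuery S Δ
  | .datalog _ _ _ => []
  | .tgd body _ head pos _ _ _ =>
      body.map (Atom.map (nameVars {t | ∃ i, i ≠ pos ∧ head.args i = t} d))

theorem Rule.consts_frontierQuery_subset {r : Rule S Δ} {d : Δ} {C : Set Δ} (h : r.consts ⊆ C) :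
    (r.frontierQuery d).consts ⊆ insert d C := by
  rintro c ⟨α, hα, i, hi⟩
  cases r with
  | datalog => simp [Rule.frontierQuery] at hα
  | tgd body z head pos fresh witness safe =>
    simp only [Rule.frontierQuery, List.mem_map] at hα
    obtain ⟨β, hβ, rfl⟩ := hα
    change nameVars _ d (β.args i) = _ at hi
    cases hx : β.args i with
    | const c' =>
      simp only [hx, nameVars, Term.const.injEq] at hi
      subst hi
      exact Or.inr (h (Or.inl ⟨β, hβ, i, hx⟩))
    | var x =>
      simp only [hx, nameVars] at hi
      split_ifs at hi
      simp only [Term.const.injEq] at hi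
      exact Or.inl hi.symm

end Frontier

theorem injOn_insert_of_forall_eq {α β : Type*} {f : α → β} {s : Set α} {a : α}
    (h : Set.InjOn f s) (ha : ∀ x ∈ s, f x = f a → x = a) : Set.InjOn f (insert a s) := by
  rintro x (rfl | hx) y (rfl | hy) hxy
  · rfl
  · exact (ha y hy hxy.symm).symm
  · exact ha x hx hxy
  · exact h hx hy hxy

/-! ### Transfer from the quotient to the chase, and the finite model -/

section Main

variable {S : Signature.{u}} {Δ : Type v} {A : Type*} {C : Set Δ} {T : RuleSet S Δ}
  {κ : Δ → ChaseTerm C T} {D : DBInstance S Δ} {K : ℕ} {q : ChaseTerm C T → A}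

/-- A query with at most one named element which is true in the datalog closure of the quotient of
the skeleton is true in the chase, for a similar choice of the named element, if its rewriting
is small. -/
theorem exists_satBy_chase [Infinite Δ] [Nonempty C] [Finite A] (hS : S.IsBinary) (hC : C.Finite)
    (hTfin : T.Finite) (hSk : (Atom.map q '' skeleton κ D).Finite)
    (hκ : ∀ c : C, κ c = (c, [])) (hD : ∀ α ∈ D, ∀ i, α.args i ∈ C) (hT : ∀ r ∈ T, r.consts ⊆ C)
    (hq : ∀ x y, q x = q y → nodeType (chaseParent κ D) (ChaseTerm.label (K + 1)) (2 * K + 2) x =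
      nodeType (chaseParent κ D) (ChaseTerm.label (K + 1)) (2 * K + 2) y)
    (hqs : q.Surjective) {Q : ConjQuery S Δ} {U : UnionQuery S Δ} (hU : IsRewriting T Q U) {d : Δ}
    (hK : ∀ Ψ ∈ U, (ConjQuery.terms Ψ ∪ Term.const '' insert d C).ncard ≤ K)
    (hQ : Q.consts ⊆ insert d C) {a : ChaseTerm C T} (ha : ∀ c ∈ C, κ c = a ↔ c = d)
    {f : Term Δ → A} (hf : Interprets (fun c => q (κ c)) C f) (hfd : f (.const d) = q a)
    (hQf : Q.SatBy {α | DatalogClosure T (fun c => q (κ c)) C (Atom.map q '' skeleton κ D) α} f) :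
    ∃ g, Interprets κ C g ∧
      nodeType (chaseParent κ D) (ChaseTerm.label (K + 1)) 1 (g (.const d)) =
        nodeType (chaseParent κ D) (ChaseTerm.label (K + 1)) 1 a ∧
      Q.SatBy {α | Chase κ D α} g := by
  have hTc : Countable T := hTfin.countable.to_subtype
  have hCc : Countable C := hC.countable.to_subtype
  have hκinj : Set.InjOn κ C := by
    intro c hc c' hc' h
    rw [hκ ⟨c, hc⟩, hκ ⟨c', hc'⟩] at h
    simpa using h
  have hqκ : ∀ x, ∀ c ∈ C, q x = q (κ c) → x = κ c := fun x c hc h =>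
    eq_const_of_label_eq (m := K + 1) hκ hc (lab_eq_of_nodeType_eq (hq _ _ h))
  have hC' : (insert d C).Finite := hC.insert d
  have hA : Nonempty A := ⟨q a⟩
  obtain ⟨Ψ, hΨU, hΨC, g₀, hg₀, hΨ⟩ := hU.exists_satBy (κ := fun c => q (κ c))
    (κ' := fun c => f (.const c)) (C' := insert d C) hT hSk hC' (by
      refine injOn_insert_of_forall_eq ?_ ?_
      · intro c hc c' hc' h
        simp only [hf c hc, hf c' hc'] at h
        exact hκinj hc hc' (hqκ _ c' hc' h)
      · intro c hc h
        rw [hf c hc, hfd] at h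
        exact (ha c hc).1 (hqκ _ c hc h.symm).symm)
    (Set.subset_insert _ _) (fun c hc => hf c hc) hQ (fun _ _ => rfl) hQf
  have hWfin : (ConjQuery.terms Ψ ∪ Term.const '' insert d C).Finite :=
    (ConjQuery.finite_terms Ψ).union (hC'.image _)
  have hx : ∀ t, q (Function.surjInv hqs (g₀ t)) = g₀ t := fun t => Function.surjInv_eq hqs _
  obtain ⟨g, hgΨ, hg⟩ := exists_satBy_skeleton hκ hD hq (Ψ := Ψ)
    (W := hWfin.toFinset) (x := fun t => Function.surjInv hqs (g₀ t)) (by simp)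
    (by rw [← Set.ncard_eq_toFinset_card _ hWfin]; exact hK Ψ hΨU) (by simpa only [hx] using hΨ)
  have hgC' : ∀ c ∈ insert d C, nodeType (chaseParent κ D) (ChaseTerm.label (K + 1)) 1
      (g (.const c)) = nodeType (chaseParent κ D) (ChaseTerm.label (K + 1)) 1
        (Function.surjInv hqs (g₀ (.const c))) := fun c hc => hg _ (by
    rw [Set.Finite.mem_toFinset]
    exact Or.inr ⟨c, hc, rfl⟩)
  have hgd : nodeType (chaseParent κ D) (ChaseTerm.label (K + 1)) 1 (g (.const d)) =
      nodeType (chaseParent κ D) (ChaseTerm.label (K + 1)) 1 a := by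
    rw [hgC' d (Set.mem_insert _ _)]
    refine nodeType_eq_of_le (by omega) (hq _ _ ?_)
    exact (hx _).trans ((hg₀ d (Set.mem_insert _ _)).trans hfd)
  have hgC : Interprets κ C g := by
    intro c hc
    refine eq_const_of_label_eq (m := K + 1) hκ hc ?_
    rw [lab_eq_of_nodeType_eq (hgC' c (Or.inr hc))]
    refine lab_eq_of_nodeType_eq (hq _ _ ?_)
    exact (hx _).trans ((hg₀ c (Or.inr hc)).trans (hf c hc))
  obtain ⟨f', hf', hQf'⟩ := hU.satBy (κ := κ) (κ' := fun c => g (.const c)) (C' := insert d C) hT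
    (fun r hr => Chase.holdsIn (D := D) hS hr) hC' (by
      refine injOn_insert_of_forall_eq ?_ ?_
      · intro c hc c' hc' h
        simp only [hgC c hc, hgC c' hc'] at h
        exact hκinj hc hc' h
      · intro c hc h
        rw [hgC c hc] at h
        refine (ha c hc).1 (eq_const_of_label_eq (m := K + 1) hκ hc ?_).symm
        rw [h]
        exact (lab_eq_of_nodeType_eq hgd).symm)
    (Set.subset_insert _ _) (fun c hc => hgC c hc) hΨU hΨC (fun _ _ => rfl)
    fun α hα => skeleton_subset_chase (hgΨ α hα)
  refine ⟨f', fun c hc => ?_, ?_, hQf'⟩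
  · rw [hf' c (Or.inr hc)]
    exact hgC c hc
  · rw [hf' d (Set.mem_insert _ _)]
    exact hgd

/-- The datalog closure of a sufficiently precise quotient of the skeleton is a model of the
existential rules. -/
theorem tgd_holdsIn_datalogClosure [Infinite Δ] [Nonempty C] [Finite A] (hS : S.IsBinary)
    (hC : C.Finite) (hTfin : T.Finite)
    (hSk : (Atom.map q '' skeleton κ D).Finite)
    (hκ : ∀ c : C, κ c = (c, [])) (hD : ∀ α ∈ D, ∀ i, α.args i ∈ C) (hT : ∀ r ∈ T, r.consts ⊆ C)
    (hq : ∀ x y, q x = q y → nodeType (chaseParent κ D) (ChaseTerm.label (K + 1)) (2 * K + 2) x =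
      nodeType (chaseParent κ D) (ChaseTerm.label (K + 1)) (2 * K + 2) y)
    (hqs : q.Surjective) {U : ConjQuery S Δ → UnionQuery S Δ} (hU : ∀ Q, IsRewriting T Q (U Q))
    {d₀ : Δ} (hd₀ : d₀ ∉ C) {r : Rule S Δ} (hr : r ∈ T)
    (hK : ∀ d ∈ insert d₀ C, ∀ Ψ ∈ U (r.frontierQuery d),
      (ConjQuery.terms Ψ ∪ Term.const '' insert d C).ncard ≤ K) :
    r.HoldsIn (fun c => q (κ c)) C
      {α | DatalogClosure T (fun c => q (κ c)) C (Atom.map q '' skeleton κ D) α} := by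
  classical
  have hκinj : Set.InjOn κ C := by
    intro c hc c' hc' h
    rw [hκ ⟨c, hc⟩, hκ ⟨c', hc'⟩] at h
    simpa using h
  cases r with
  | datalog => exact fun f hf hb => DatalogClosure.datalog hr f hf hb
  | tgd body z head pos fresh witness safe =>
    intro f hf hb
    have hA : Nonempty A := ⟨f (.var 0)⟩
    obtain ⟨b, hfb⟩ := hS.exists_eq_of_ne pos fun i => f (head.args i)
    obtain ⟨a, rfl⟩ := hqs b
    -- The frontier element keeps its own name if it is a constant of `C`, and otherwise gets the
    -- fresh name `d₀`; naming thus remains injective.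
    obtain ⟨d, hdC, hd⟩ : ∃ d ∈ insert d₀ C, ∀ c ∈ C, κ c = a ↔ c = d := by
      by_cases h : ∃ c ∈ C, κ c = a
      · obtain ⟨c, hc, rfl⟩ := h
        exact ⟨c, Or.inr hc, fun c' hc' => hκinj.eq_iff hc' hc⟩
      · refine ⟨d₀, Set.mem_insert _ _, fun c hc => ⟨fun h' => (h ⟨c, hc, h'⟩).elim, ?_⟩⟩
        rintro rfl
        exact (hd₀ hc).elim
    let f' : Term Δ → A := Function.update f (.const d) (q a)
    have hf'd : f' (.const d) = q a := Function.update_self ..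
    have hf'C : Interprets (fun c => q (κ c)) C f' := by
      intro c hc
      by_cases hcd : c = d
      · change _ = q (κ c)
        rw [(hd c hc).2 hcd, hcd, hf'd]
      · have : Term.const c ≠ Term.const d := by simpa using hcd
        simp only [f', Function.update_of_ne this]
        exact hf c hc
    have hf'v : ∀ x, f' (.var x) = f (.var x) := fun x =>
      Function.update_of_ne (by simp) _ _
    obtain ⟨g, hgC, hgd, hg⟩ := exists_satBy_chase hS hC hTfin hSk hκ hD hT hq hqs
      (hU ((Rule.tgd body z head pos fresh witness safe).frontierQuery d)) (hK d hdC)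
      (Rule.consts_frontierQuery_subset (hT _ hr)) hd hf'C hf'd (by
        intro α hα
        simp only [Rule.frontierQuery, List.mem_map] at hα
        obtain ⟨β, hβ, rfl⟩ := hα
        have hβf : (β.map (nameVars {t | ∃ i, i ≠ pos ∧ head.args i = t} d)).map f' =
            β.map f := by
          refine Atom.map_congr (α := β) (g := f)
            (f := fun t => f' (nameVars {t | ∃ i, i ≠ pos ∧ head.args i = t} d t)) fun i => ?_
          cases hx : β.args i with
          | const c =>
            have hc : c ∈ C := hT _ hr (Or.inl ⟨β, hβ, i, hx⟩)
            exact (hf'C c hc).trans (hf c hc).symm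
          | var x =>
            simp only [nameVars, Set.mem_ofPred_eq]
            split_ifs with h
            · obtain ⟨j, hj, hjx⟩ := h
              rw [hf'd, ← hjx, hfb j hj]
            · exact hf'v x
        rw [hβf]
        exact hb β hβ)
    have hfires : (Rule.tgd body z head pos fresh witness safe).Fires κ C {α | Chase κ D α}
        (g (.const d)) := by
      refine ⟨fun t => g (nameVars {t | ∃ i, i ≠ pos ∧ head.args i = t} d t),
        fun c hc => hgC c hc, fun α hα => hg _ (List.mem_map.2 ⟨α, hα, rfl⟩), fun i hi => ?_⟩
      cases hx : head.args i with
      | const c =>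
        have hc : c ∈ C := hT _ hr (Or.inr ⟨i, hx⟩)
        have hca : a = κ c := by
          refine eq_const_of_label_eq (m := K + 1) hκ hc (lab_eq_of_nodeType_eq (hq _ _ ?_))
          rw [← hfb i hi, hx]
          exact hf c hc
        rw [← (hd c hc).1 hca.symm]
        rfl
      | var x =>
        have : Term.var x ∈ {t | ∃ i, i ≠ pos ∧ head.args i = t} := ⟨i, hi, hx⟩
        simp only [nameVars, if_pos this]
    -- Agreement of depth `1` suffices: the child created at `g (.const d)` forces a child of `a`
    -- with the same label, so the rule fires at `a` as well.
    obtain ⟨y, hy, hyl⟩ := exists_child_of_nodeType_eq hgd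
      (chaseParent_child (r := ⟨_, hr⟩) hfires)
    obtain ⟨-, hfires'⟩ := eq_child_of_label_eq hyl hy
    refine ⟨q (ChaseTerm.child ⟨_, hr⟩ a), DatalogClosure.base
      ⟨_, Or.inr ⟨⟨_, hr⟩, a, hfires', rfl⟩, ?_⟩⟩
    simp only [Atom.map, Rule.headFact, Atom.mk.injEq, heq_eq_eq, true_and]
    funext i
    split_ifs with hi
    · rfl
    · exact (hfb i hi).symm

/-- A BDD theory over a finite binary signature is finitely controllable. -/
theorem IsBDD.isFC [Infinite Δ] [Finite S.Pred] (hS : S.IsBinary) (hTfin : T.Finite)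
    (hBDD : IsBDD T) : IsFC T := by
  intro D hDfin Φ hΦ
  obtain ⟨N, hN, hNΦ⟩ : ∃ N, IsModel N D T ∧ ¬ Φ.Holds N := by
    simpa [Entails] using hΦ
  choose U hU using hBDD
  have c₀ : Δ := Classical.arbitrary Δ
  obtain ⟨C, hC, hT, hD, hΦC, hc₀⟩ : ∃ C : Set Δ, C.Finite ∧ (∀ r ∈ T, r.consts ⊆ C) ∧
      (∀ α ∈ D, ∀ i, α.args i ∈ C) ∧ Φ.consts ⊆ C ∧ c₀ ∈ C := by
    refine ⟨(⋃ r ∈ T, r.consts) ∪ (⋃ α ∈ D, Set.range α.args) ∪ Φ.consts ∪ {c₀}, ?_, ?_, ?_,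
      ?_, Or.inr rfl⟩
    · exact (((hTfin.biUnion fun r _ => r.finite_consts).union
        (hDfin.biUnion fun α _ => Set.finite_range _)).union Φ.finite_consts).union
        (Set.finite_singleton _)
    · exact fun r hr c hc => Or.inl (Or.inl (Or.inl (Set.mem_biUnion hr hc)))
    · exact fun α hα i => Or.inl (Or.inl (Or.inr (Set.mem_biUnion hα ⟨i, rfl⟩)))
    · exact fun c hc => Or.inl (Or.inr hc)
  obtain ⟨d₀, hd₀⟩ := hC.exists_notMem
  have hCne : Nonempty C := ⟨⟨c₀, hc₀⟩⟩
  obtain ⟨κ, hκ⟩ : ∃ κ : Δ → ChaseTerm C T, ∀ c : C, κ c = (c, []) := by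
    classical
    exact ⟨fun c => if h : c ∈ C then (⟨c, h⟩, []) else (⟨c₀, hc₀⟩, []), fun c => by simp⟩
  -- The finitely many queries to be transferred; `K` bounds the disjuncts of their rewritings, with
  -- all named constants counted as terms.
  let queries : Set (ConjQuery S Δ) :=
    insert Φ (Set.image2 (fun r d => r.frontierQuery d) T (insert d₀ C))
  have hqueries : queries.Finite := (hTfin.image2 _ (hC.insert d₀)).insert Φ
  obtain ⟨K, hK⟩ : ∃ K, ∀ Q ∈ queries, ∀ d ∈ insert d₀ C, ∀ Ψ ∈ U Q,
      (ConjQuery.terms Ψ ∪ Term.const '' insert d C).ncard ≤ K := by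
    have hfin : (Set.image2
        (fun Ψ d => (ConjQuery.terms Ψ ∪ Term.const '' insert d C).ncard)
        (⋃ Q ∈ queries, {Ψ | Ψ ∈ U Q}) (insert d₀ C)).Finite :=
      (hqueries.biUnion fun Q _ => List.finite_toSet (U Q)).image2 _ (hC.insert d₀)
    obtain ⟨K, hK⟩ := hfin.bddAbove
    exact ⟨K, fun Q hQ d hd Ψ hΨ => hK ⟨Ψ, Set.mem_biUnion hQ hΨ, d, hd, rfl⟩⟩
  have := hC.to_subtype
  have := hTfin.to_subtype
  let q : ChaseTerm C T → Set.range
      (nodeType (chaseParent κ D) (ChaseTerm.label (K + 1)) (2 * K + 2)) := Set.rangeFactorization _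
  have hqs : q.Surjective := Set.rangeFactorization_surjective
  have hq : ∀ x y, q x = q y →
      nodeType (chaseParent κ D) (ChaseTerm.label (K + 1)) (2 * K + 2) x =
        nodeType (chaseParent κ D) (ChaseTerm.label (K + 1)) (2 * K + 2) y :=
    fun x y h => congrArg Subtype.val h
  have : Finite (ZMod (K + 1)) := inferInstanceAs (Finite (Fin (K + 1)))
  have hSk : (Atom.map q '' skeleton κ D).Finite := Set.toFinite _
  have hne : Nonempty (Set.range
      (nodeType (chaseParent κ D) (ChaseTerm.label (K + 1)) (2 * K + 2))) := ⟨q (κ c₀)⟩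
  have hqκ : Set.InjOn (fun c => q (κ c)) C := by
    intro c hc c' hc' h
    have h := eq_const_of_label_eq (m := K + 1) hκ hc' (lab_eq_of_nodeType_eq (hq _ _ h))
    rw [hκ ⟨c, hc⟩, hκ ⟨c', hc'⟩] at h
    simpa using h
  have hκinj : Set.InjOn κ C := fun c hc c' hc' h => hqκ hc hc' (congrArg q h)
  obtain ⟨e, he, heκ, -⟩ := exists_injective_extension hC Set.finite_empty hqκ
  let X := {α | DatalogClosure T (fun c => q (κ c)) C (Atom.map q '' skeleton κ D) α}
  refine ⟨Atom.map e '' X, (Set.toFinite X).image _, ⟨fun α hα => ?_, fun r hr => ?_⟩, ?_⟩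
  · refine ⟨_, DatalogClosure.base ⟨_, Or.inl ⟨α, hα, rfl⟩, rfl⟩, ?_⟩
    exact Atom.map_congr (f := fun c => e (q (κ c))) (g := id) fun i => heκ _ (hD α hα i)
  · refine Rule.HoldsIn.holds_image he heκ (hT r hr) ?_
    exact tgd_holdsIn_datalogClosure hS hC hTfin hSk hκ hD hT hq hqs hU hd₀ hr
      fun d hd => hK _ (Or.inr ⟨r, hr, d, hd, rfl⟩) d hd
  · rintro ⟨ν, hν⟩
    have hf := interprets_invFun he heκ ν
    -- `Φ` needs no extra name, so the distinguished element is the dummy `c₀`, already in `C`.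
    obtain ⟨g, hg, -, hgΦ⟩ := exists_satBy_chase (a := κ c₀) (d := c₀) hS hC hTfin hSk hκ hD
      hT hq hqs (hU Φ) (hK Φ (Or.inl rfl) c₀ (Or.inr hc₀)) (hΦC.trans (Set.subset_insert _ _))
      (fun c hc => hκinj.eq_iff hc hc₀) hf (hf c₀ hc₀)
      fun α hα => Atom.map_invFun_mem he (hν α hα)
    obtain ⟨h, hhκ, hh⟩ := Chase.exists_hom hκ hT hD hN
    refine hNΦ ⟨fun x => h (g (.var x)), fun α hα => ?_⟩
    rw [← Atom.map_map_eq_ground (fun c hc => hΦC ⟨α, hα, hc⟩) hg hhκ]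
    exact hh _ (hgΦ α hα)

end Main

end DatalogEx

theorem theorem1 {Δ : Type*} [Infinite Δ] (S : DatalogEx.Signature) [Finite S.Pred]
    (hS : S.IsBinary) (T : DatalogEx.RuleSet S Δ) (hT : T.Finite) (hBDD : DatalogEx.IsBDD T) :
    DatalogEx.IsFC T :=
  hBDD.isFC hS hT
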